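/- Let $D$ be a finite simple digraph (no self loops and no multiple arcs; the two opposite arcs $\langle u,v\rangle$ and $\langle v,u\rangle$ may both be present) on $n > 2$ vertices. Write $d^+(u)$ for the number of arcs leaving $u$ and $d^-(v)$ for the number of arcs entering $v$. Suppose that $d^+(u) + d^-(v) \ge n + 2$ for all pairs of distinct vertices $u, v$ such that $\langle u, v\rangle$ is not an arc of $D$. Then $D$ contains at least two arc-disjoint Hamiltonian cycles, that is, two directed cycles through all the vertices of $D$ that have no arc in common. -/

import Mathlib

namespace Digraph

variable {V : Type*}

/-- The digraph has no self loops. (Parallel arcs cannot occur, as arcs are given by a relation.) -/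
def IsSimple (D : Digraph V) : Prop := ∀ v, ¬ D.Adj v v

/-- `d⁺(v)`: the number of arcs leaving `v`. -/
noncomputable def outDeg (D : Digraph V) (v : V) : ℕ := {w | D.Adj v w}.ncard

/-- `d⁻(v)`: the number of arcs entering `v`. -/
noncomputable def inDeg (D : Digraph V) (v : V) : ℕ := {u | D.Adj u v}.ncard

/-- `C` is the arc set of a directed Hamiltonian cycle of `D`: every element of `C` is an arc
of `D`, and for some enumeration `v₀, …, vₙ₋₁` of all vertices (each listed exactly once), `C`
consists of the pairs `(v₀, v₁), …, (vₙ₋₂, vₙ₋₁), (vₙ₋₁, v₀)`. -/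
def IsHamiltonianCycle [Fintype V] (D : Digraph V) (C : Set (V × V)) : Prop :=
  (∀ a ∈ C, D.Adj a.1 a.2) ∧
    ∃ e : Fin (Fintype.card V) ≃ V, C = Set.range fun i => (e i, e (finRotate _ i))

end Digraph

/-! Delete from `D` the arcs `⟨v, π v⟩` of a cyclic order `π` of the vertices. What remains
satisfies Ore's condition `d⁺(u) + d⁻(v) ≥ n` at all non-adjacent pairs other than the pairs
`(v, π v)`, and it suffices to find a Hamiltonian cycle there: a second application, with the
successor permutation of that cycle in place of `π`, produces a cycle that shares no arc with the
first.

Suppose that a longest cycle misses a vertex `z`. Since walks through `z` leave and re-enter the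
cycle, there are detours that bypass a segment `x 0, …, x i` of it. For a detour bypassing the
fewest vertices, the degree conditions at `x 0` and `x i` exactly exhaust the room left by the
absence of a longer cycle. So every count is attained, which has two consequences. First, `π` must
block all vertices reachable from `z` at one and the same attachment, and since `π` is injective,
the cycle misses `z` only. Secondly, along the kept part of the cycle there is a threshold `x s`:
the vertices up to `x s` are out-neighbours of `z` and those from `x s` on are in-neighbours of `z`.
Using the detour and reinserting the bypassed segment around `x s` gives a cycle of the same length
that misses `x s` instead of `z`, while `d⁺(z) < d⁻(x s)` and `d⁻(z) < d⁺(x s)`. This is impossible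
if `z` was chosen of largest total degree among the vertices missed by longest cycles.
-/

open Finset
open scoped Classical

section Walks

variable {V : Type*} {A : V → V → Prop} {a b c d : V} {l l₁ l₂ : List V}

/-- A walk along `A` from `a` to `b`, given as the list of its vertices. -/
structure IsWalk (A : V → V → Prop) (a b : V) (l : List V) : Prop where
  chain : l.IsChain A
  head : l.head? = some a
  last : l.getLast? = some b

theorem IsWalk.singleton (a : V) : IsWalk A a a [a] := ⟨by simp, rfl, rfl⟩

theorem IsWalk.append (h₁ : IsWalk A a b l₁) (h : A b c) (h₂ : IsWalk A c d l₂) :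
    IsWalk A a d (l₁ ++ l₂) where
  chain := List.isChain_append.2 ⟨h₁.chain, h₂.chain, by simpa [h₁.last, h₂.head] using h⟩
  head := by simp [h₁.head]
  last := by simp [h₂.last]

theorem IsWalk.exists_nodup_of_reflTransGen {P : V → Prop}
    (h : Relation.ReflTransGen (fun u v => A u v ∧ P u ∧ P v) a b) (hb : P b) :
    ∃ l, IsWalk A a b l ∧ l.Nodup ∧ ∀ w ∈ l, P w := by
  induction h using Relation.ReflTransGen.head_induction_on with
  | refl => exact ⟨[b], .singleton b, List.nodup_singleton b, by simpa⟩
  | @head a c hac _ ih =>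
    obtain ⟨l, hl, hd, hP⟩ := ih
    by_cases ha : a ∈ l
    · obtain ⟨s, t, rfl⟩ := List.append_of_mem ha
      refine ⟨a :: t, ⟨(List.isChain_append.1 hl.chain).2.1, rfl, ?_⟩,
        (List.nodup_append.1 hd).2.1, fun w hw => hP w (List.mem_append_right _ hw)⟩
      simpa [List.getLast?_append] using hl.last
    · refine ⟨[a] ++ l, (IsWalk.singleton a).append hac.1 hl, by simp [ha, hd], ?_⟩
      simpa using ⟨hac.2.1, hP⟩

/-- The list `x j, x (j + 1), …, x k`. -/
def vertexSegment (x : ℤ → V) (j k : ℤ) : List V :=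
  (List.range (k + 1 - j).toNat).map fun t : ℕ => x (j + t)

theorem mem_vertexSegment {x : ℤ → V} {j k : ℤ} {v : V} :
    v ∈ vertexSegment x j k ↔ ∃ t, j ≤ t ∧ t ≤ k ∧ x t = v := by
  simp only [vertexSegment, List.mem_map, List.mem_range]
  constructor
  · rintro ⟨t, ht, rfl⟩
    exact ⟨j + t, by lia, by lia, rfl⟩
  · rintro ⟨t, hj, hk, rfl⟩
    exact ⟨(t - j).toNat, by lia, congrArg x (by lia)⟩

theorem length_vertexSegment (x : ℤ → V) (j k : ℤ) :
    (vertexSegment x j k).length = (k + 1 - j).toNat := by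
  simp [vertexSegment]

theorem isWalk_vertexSegment {x : ℤ → V} (h : ∀ k, A (x k) (x (k + 1))) {j k : ℤ} (hjk : j ≤ k) :
    IsWalk A (x j) (x k) (vertexSegment x j k) := by
  induction k, hjk using Int.leInduction with
  | base => simpa [vertexSegment] using IsWalk.singleton (A := A) (x j)
  | succ k hjk ih =>
    have hsnoc : vertexSegment x j (k + 1) = vertexSegment x j k ++ [x (k + 1)] := by
      rw [vertexSegment, vertexSegment, show (k + 1 + 1 - j).toNat = (k + 1 - j).toNat + 1 by lia,
        List.range_succ, List.map_append, List.map_singleton]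
      congr 3
      lia
    rw [hsnoc]
    exact ih.append (h k) (.singleton _)

end Walks

section CyclicWalks

variable {V : Type*} {A : V → V → Prop} {m : ℕ} {x : ℤ → V}

/-- A cycle of length `m` along `A`, its vertices being listed periodically as
`…, x (-1), x 0, x 1, …`. -/
structure IsCyclicWalk (A : V → V → Prop) (m : ℕ) (x : ℤ → V) : Prop where
  pos : 0 < m
  eq_iff : ∀ {j k}, x j = x k ↔ j ≡ k [ZMOD m]
  adj : ∀ k, A (x k) (x (k + 1))

theorem IsWalk.exists_isCyclicWalk {a b : V} {l : List V} (hl : IsWalk A a b l) (hd : l.Nodup)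
    (hba : A b a) : ∃ y, IsCyclicWalk A l.length y ∧ ∀ k, y k ∈ l := by
  have hpos : 0 < l.length := List.length_pos_iff.2 (by rintro rfl; simpa using hl.head)
  have hlt (k : ℤ) : (k % l.length).toNat < l.length := by
    have := Int.emod_lt_of_pos k (Nat.cast_pos.2 hpos)
    lia
  have hnonneg (k : ℤ) : 0 ≤ k % l.length := Int.emod_nonneg _ (by lia)
  have hfirst : l[0] = a := by simpa [List.head?_eq_getElem?, hpos] using hl.head
  have hlast : l[l.length - 1] = b := by
    simpa [List.getLast?_eq_getElem?, hpos] using hl.last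
  refine ⟨fun k => l[(k % l.length).toNat]'(hlt k), ⟨hpos, fun {j k} => ?_, fun k => ?_⟩,
    fun k => List.getElem_mem _⟩
  · rw [hd.getElem_inj_iff, Int.ModEq]
    have := hnonneg j
    have := hnonneg k
    lia
  · by_cases hk : k % l.length + 1 = l.length
    · have hk' : (k + 1) % (l.length : ℤ) = 0 := by rw [← Int.emod_add_emod, hk, Int.emod_self]
      simpa only [hk', show (k % l.length).toNat = l.length - 1 by lia, Int.toNat_zero, hfirst,
        hlast] using hba
    · have hk' : (k + 1) % (l.length : ℤ) = k % l.length + 1 := by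
        have := hlt k
        have := hnonneg k
        rw [← Int.emod_add_emod, Int.emod_eq_of_lt] <;> lia
      have hsucc : (k % l.length + 1).toNat = (k % l.length).toNat + 1 := by
        have := hnonneg k
        lia
      simp only [hk', hsucc]
      exact List.isChain_iff_getElem.1 hl.chain _ (by have := hlt k; lia)

namespace IsCyclicWalk

theorem periodic (h : IsCyclicWalk A m x) : Function.Periodic x m := fun _ =>
  h.eq_iff.2 (Int.add_modEq_right ..)

theorem apply_emod (h : IsCyclicWalk A m x) (k : ℤ) : x (k % m) = x k :=
  h.eq_iff.2 (Int.mod_modEq k m)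

theorem eq_of_lt_add (h : IsCyclicWalk A m x) {j k : ℤ} (hjk : j < k + m) (hkj : k < j + m)
    (e : x j = x k) : j = k := by
  have := Int.eq_zero_of_abs_lt_dvd (h.eq_iff.1 e).dvd (abs_lt.2 ⟨by lia, by lia⟩)
  lia

theorem exists_mem_Ico (h : IsCyclicWalk A m x) (q k : ℤ) : ∃ t ∈ Set.Ico q (q + m), x t = x k := by
  have hm : (0 : ℤ) < m := Nat.cast_pos.2 h.pos
  refine ⟨q + (k - q) % m,
    ⟨by have := Int.emod_nonneg (k - q) hm.ne'; lia, by have := Int.emod_lt_of_pos (k - q) hm; lia⟩,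
    h.eq_iff.2 ?_⟩
  simpa using (Int.ModEq.refl q).add (Int.mod_modEq (k - q) m)

theorem shift (h : IsCyclicWalk A m x) (q : ℤ) : IsCyclicWalk A m fun k => x (k + q) where
  pos := h.pos
  eq_iff {j k} := h.eq_iff.trans
    ⟨fun e => Int.ModEq.add_right_cancel' q e, fun e => e.add_right q⟩
  adj k := by simpa [add_right_comm] using h.adj (k + q)

theorem reflect (h : IsCyclicWalk A m x) (i : ℤ) :
    IsCyclicWalk (flip A) m fun k => x (i - k) where
  pos := h.pos
  eq_iff {j k} := h.eq_iff.trans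
    ⟨fun e => by simpa using (Int.ModEq.refl i).sub e, fun e => (Int.ModEq.refl i).sub e⟩
  adj k := by simpa [flip, sub_add_eq_sub_sub] using h.adj (i - (k + 1))

theorem nodup_vertexSegment (h : IsCyclicWalk A m x) {j k : ℤ} (hk : k < j + m) :
    (vertexSegment x j k).Nodup := by
  refine List.Nodup.map_on (fun s hs t ht e => ?_) List.nodup_range
  rw [List.mem_range] at hs ht
  have := h.eq_of_lt_add (by lia) (by lia) e
  lia

theorem disjoint_vertexSegment (h : IsCyclicWalk A m x) {j k j' k' : ℤ} (hkj : k < j')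
    (hk' : k' < j + m) : (vertexSegment x j k).Disjoint (vertexSegment x j' k') := by
  intro v hv hv'
  obtain ⟨t, hjt, htk, rfl⟩ := mem_vertexSegment.1 hv
  obtain ⟨s, hjs, hsk, e⟩ := mem_vertexSegment.1 hv'
  have := h.eq_of_lt_add (by lia) (by lia) e
  lia

theorem disjoint_vertexSegment_of_notMem {Z : List V} (hZ : ∀ k, x k ∉ Z) (j k : ℤ) :
    (vertexSegment x j k).Disjoint Z := by
  intro v hv
  obtain ⟨t, -, -, rfl⟩ := mem_vertexSegment.1 hv
  exact hZ t

theorem insert (h : IsCyclicWalk A m x) {u v : V} {Z : List V} (hZ : IsWalk A u v Z)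
    (hZd : Z.Nodup) (hZx : ∀ k, x k ∉ Z) (hu : A (x (-1)) u) (hv : A v (x 0)) :
    ∃ y, IsCyclicWalk A (m + Z.length) y := by
  have hm := h.pos
  have hu' : A (x (m - 1)) u := by rwa [sub_eq_neg_add, h.periodic]
  obtain ⟨y, hy, -⟩ := ((isWalk_vertexSegment h.adj (show 0 ≤ (m : ℤ) - 1 by lia)).append hu'
    hZ).exists_isCyclicWalk ((h.nodup_vertexSegment (by lia)).append hZd
      (disjoint_vertexSegment_of_notMem hZx _ _)) hv
  rw [List.length_append, length_vertexSegment] at hy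
  exact ⟨y, by convert hy using 1; lia⟩

/-- The new cycle runs through `x (i + 1), …, x l`, then `x 0, …, x i`, then `x l', …, x (m - 1)`
and returns along `Z`. -/
theorem exchange (h : IsCyclicWalk A m x) {i l l' : ℤ} (hi : 0 ≤ i) (hil : i < l) (hll : l < l')
    (hl' : l' < m) {u v : V} {Z : List V} (hZ : IsWalk A u v Z) (hZd : Z.Nodup)
    (hZx : ∀ k, x k ∉ Z) (hu : A (x (-1)) u) (hv : A v (x (i + 1))) (h₁ : A (x l) (x 0))
    (h₂ : A (x i) (x l')) :
    ∃ y, IsCyclicWalk A (m + Z.length - (l' - l - 1).toNat) y ∧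
      ∀ t, l < t → t < l' → ∀ k, y k ≠ x t := by
  have hu' : A (x (m - 1)) u := by rwa [sub_eq_neg_add, h.periodic]
  have hwalk := (((isWalk_vertexSegment h.adj (show i + 1 ≤ l by lia)).append h₁
    (isWalk_vertexSegment h.adj hi)).append h₂
      (isWalk_vertexSegment h.adj (show l' ≤ (m : ℤ) - 1 by lia))).append hu' hZ
  obtain ⟨y, hy, hmem⟩ := hwalk.exists_isCyclicWalk
    (List.Nodup.append (List.Nodup.append (List.Nodup.append (h.nodup_vertexSegment (by lia))
      (h.nodup_vertexSegment (by lia)) (h.disjoint_vertexSegment (by lia) (by lia)).symm)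
      (h.nodup_vertexSegment (by lia)) (List.disjoint_append_left.2
        ⟨h.disjoint_vertexSegment (by lia) (by lia), h.disjoint_vertexSegment (by lia) (by lia)⟩))
      hZd (by simp [List.disjoint_append_left, disjoint_vertexSegment_of_notMem hZx])) hv
  refine ⟨y, ?_, fun t hlt htl k hk => ?_⟩
  · simp only [List.length_append, length_vertexSegment] at hy
    convert hy using 1
    lia
  · have hyk := hmem k
    simp only [hk, List.mem_append, mem_vertexSegment, hZx, or_false] at hyk
    obtain (⟨s, hs, hs', e⟩ | ⟨s, hs, hs', e⟩) | ⟨s, hs, hs', e⟩ := hyk <;>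
      have := h.eq_of_lt_add (by lia) (by lia) e <;> lia

theorem injective_fin (h : IsCyclicWalk A m x) : Function.Injective fun i : Fin m => x i :=
  fun i j e =>
    Fin.ext (Int.ofNat_inj.1 (h.eq_of_lt_add (by omega) (by omega) e))

theorem le_card [Finite V] (h : IsCyclicWalk A m x) : m ≤ Nat.card V := by
  rw [← Nat.card_fin m]
  exact Nat.card_le_card_of_injective _ h.injective_fin

end IsCyclicWalk

theorem exists_isCyclicWalk [Finite V] [Nonempty V] (h : ∀ u, ∃ v, A u v) :
    ∃ m x, IsCyclicWalk A m x := by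
  obtain ⟨a, ha⟩ : ∃ a, Relation.TransGen A a a := by
    by_contra! hirr
    have : Std.Irrefl (flip (Relation.TransGen A)) := ⟨hirr⟩
    have : IsTrans V (flip (Relation.TransGen A)) := ⟨fun _ _ _ hab hbc => hbc.trans hab⟩
    obtain ⟨a, -, ha⟩ := (Finite.wellFounded_of_trans_of_irrefl
      (flip (Relation.TransGen A))).has_min Set.univ Set.univ_nonempty
    obtain ⟨b, hab⟩ := h a
    exact ha b trivial (.single hab)
  obtain ⟨b, hab, hba⟩ := Relation.TransGen.tail'_iff.1 ha
  obtain ⟨l, hl, hd, -⟩ := IsWalk.exists_nodup_of_reflTransGen (A := A) (P := fun _ => True)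
    (by simpa using hab) trivial
  obtain ⟨y, hy, -⟩ := hl.exists_isCyclicWalk hd hba
  exact ⟨_, y, hy⟩

theorem exists_longest_isCyclicWalk [Finite V] [Nonempty V] (h : ∀ u, ∃ v, A u v) :
    ∃ m x, IsCyclicWalk A m x ∧ ∀ m' y, IsCyclicWalk A m' y → m' ≤ m := by
  obtain ⟨m, ⟨x, hx⟩, hm⟩ := BddAbove.exists_isGreatest_of_nonempty
    (S := {m | ∃ x, IsCyclicWalk A m x}) ⟨Nat.card V, fun _ ⟨_, hy⟩ => hy.le_card⟩
    (exists_isCyclicWalk h)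
  exact ⟨m, x, hx, fun m' y hy => hm ⟨y, hy⟩⟩

end CyclicWalks

section OreOff

variable {V : Type*} [Fintype V] {A : V → V → Prop} {π : Equiv.Perm V}

theorem card_filter_eq_add_compl (C : Finset V) (P : V → Prop) :
    #{v | P v} = #{v ∈ C | P v} + #{v ∈ Cᶜ | P v} := by
  rw [← card_union_of_disjoint (disjoint_filter_filter disjoint_compl_right), ← filter_union,
    union_compl]

theorem card_filter_add_card_le {P : V → Prop} {F : Finset V} (h : ∀ w ∈ F, ¬P w) :
    #{w | P w} + #F ≤ Fintype.card V := by
  rw [← card_union_of_disjoint]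
  · exact card_le_univ _
  · exact disjoint_left.2 fun w hw hF => h w hF (mem_filter.1 hw).2

/-- The loopless relation `A` satisfies Ore's degree condition at all non-adjacent pairs except the
pairs `(v, π v)`, which are all non-adjacent. It is what remains of a digraph in which
`d⁺(u) + d⁻(v) ≥ n + 2` for non-adjacent pairs once the arcs of a Hamiltonian cycle, with successor
permutation `π`, are deleted. -/
structure IsOreOff (A : V → V → Prop) (π : Equiv.Perm V) : Prop where
  irrefl : ∀ v, ¬A v v
  ne : ∀ v, π v ≠ v
  not_adj : ∀ v, ¬A v (π v)
  ore : ∀ {u v}, u ≠ v → ¬A u v → π u ≠ v → Fintype.card V ≤ #{w | A u w} + #{w | A w v}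

namespace IsOreOff

theorem flip (H : IsOreOff A π) : IsOreOff (flip A) π⁻¹ where
  irrefl := H.irrefl
  ne v h := H.ne v (Equiv.Perm.inv_eq_iff_eq.1 h).symm
  not_adj v h := H.not_adj (π⁻¹ v) (by simpa [_root_.flip] using h)
  ore {u v} huv h hπ := by
    rw [add_comm]
    exact H.ore huv.symm h fun e => hπ (Equiv.Perm.inv_eq_iff_eq.2 e.symm)

theorem two_le_card_entering (H : IsOreOff A π) (hV : 4 ≤ Fintype.card V) {T : Finset V}
    (hT : T.Nonempty) (hT' : 2 ≤ #Tᶜ) : 2 ≤ #{u ∈ Tᶜ | ∃ t ∈ T, A u t} := by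
  by_contra! hI
  set I := {u ∈ Tᶜ | ∃ t ∈ T, A u t}
  have hsplit : #T + (#I + #(Tᶜ \ I)) = Fintype.card V := by
    rw [add_comm #I, card_sdiff_add_card_eq_card (filter_subset _ _), card_add_card_compl]
  have hno : ∀ u ∈ Tᶜ \ I, ∀ t ∈ T, ¬A u t := by grind
  have hπ : ∀ u ∈ Tᶜ \ I, ∀ t ∈ T, π u = t := by
    intro u hu t ht
    by_contra hut
    have huT : u ∉ T := mem_compl.1 (mem_sdiff.1 hu).1
    have hore := H.ore (ne_of_mem_of_not_mem ht huT).symm (hno u hu t ht) hut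
    have hout : #{w | A u w} + #(insert u T) ≤ Fintype.card V :=
      card_filter_add_card_le (by simpa [H.irrefl u] using hno u hu)
    have hin : #{w | A w t} + #(insert t (Tᶜ \ I)) ≤ Fintype.card V :=
      card_filter_add_card_le (by
        simpa [H.irrefl t] using fun w hw hw' => hno w (by simp [hw, hw']) t ht)
    rw [card_insert_of_notMem huT] at hout
    rw [card_insert_of_notMem (by simp [ht])] at hin
    lia
  obtain ⟨t, ht⟩ := hT
  have hU : #(Tᶜ \ I) ≤ 1 := card_le_one.2 fun a ha b hb =>
    π.injective ((hπ a ha t ht).trans (hπ b hb t ht).symm)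
  obtain ⟨u, hu⟩ : (Tᶜ \ I).Nonempty := by
    rw [← card_pos]
    have := card_add_card_compl T
    lia
  have hT1 : #T ≤ 1 := card_le_one.2 fun a ha b hb => (hπ u hu a ha).symm.trans (hπ u hu b hb)
  lia

end IsOreOff

end OreOff

section LongestCycles

variable {V : Type*} {A : V → V → Prop} {C : Finset V} {m : ℕ} {x : ℤ → V} {u v z : V}

/-- `v` can be reached from `u` by a walk outside `C`. -/
def ReachOff (A : V → V → Prop) (C : Finset V) : V → V → Prop :=
  Relation.ReflTransGen fun u v => A u v ∧ u ∉ C ∧ v ∉ C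

/-- There is a walk from `a` to `z` all of whose vertices but `a` lie outside `C`. -/
def Enters (A : V → V → Prop) (C : Finset V) (z a : V) : Prop :=
  ∃ v ∉ C, A a v ∧ ReachOff A C v z

/-- There is a walk from `z` to `b` all of whose vertices but `b` lie outside `C`. -/
def Leaves (A : V → V → Prop) (C : Finset V) (z b : V) : Prop :=
  ∃ v ∉ C, A v b ∧ ReachOff A C z v

theorem reachOff_flip : ReachOff (flip A) C u v ↔ ReachOff A C v u := by
  rw [ReachOff, ReachOff, ← Relation.reflTransGen_swap]
  exact ⟨Relation.ReflTransGen.mono (fun _ _ h => ⟨h.1, h.2.symm⟩) _ _,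
    Relation.ReflTransGen.mono (fun _ _ h => ⟨h.1, h.2.symm⟩) _ _⟩

theorem enters_flip : Enters (flip A) C z v ↔ Leaves A C z v := by
  simp only [Enters, Leaves, reachOff_flip, flip]

theorem leaves_flip : Leaves (flip A) C z v ↔ Enters A C z v := by
  simp only [Enters, Leaves, reachOff_flip, flip]

theorem ReachOff.notMem (h : ReachOff A C u v) (hu : u ∉ C) : v ∉ C := by
  cases h with
  | refl => exact hu
  | tail _ h => exact h.2.2

theorem ReachOff.exists_isWalk (h : ReachOff A C u v) (hu : u ∉ C) :
    ∃ Z, IsWalk A u v Z ∧ Z.Nodup ∧ (∀ w ∈ Z, w ∉ C) ∧ 0 < Z.length := by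
  obtain ⟨Z, hZ, hd, hC⟩ := IsWalk.exists_nodup_of_reflTransGen h (h.notMem hu)
  refine ⟨Z, hZ, hd, hC, List.length_pos_iff.2 ?_⟩
  rintro rfl
  simpa using hZ.head

/-- `x` runs around a longest cycle, with vertex set `C`. -/
structure IsLongestCycle (A : V → V → Prop) (C : Finset V) (m : ℕ) (x : ℤ → V) : Prop
    extends IsCyclicWalk A m x where
  mem_iff : ∀ v, v ∈ C ↔ ∃ k, x k = v
  le : ∀ m' y, IsCyclicWalk A m' y → m' ≤ m

namespace IsLongestCycle

theorem apply_mem (L : IsLongestCycle A C m x) (k : ℤ) : x k ∈ C := (L.mem_iff _).2 ⟨k, rfl⟩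

theorem shift (L : IsLongestCycle A C m x) (q : ℤ) :
    IsLongestCycle A C m fun k => x (k + q) where
  toIsCyclicWalk := L.toIsCyclicWalk.shift q
  mem_iff v := (L.mem_iff v).trans
    ⟨fun ⟨k, hk⟩ => ⟨k - q, by simpa using hk⟩, fun ⟨k, hk⟩ => ⟨k + q, hk⟩⟩
  le := L.le

theorem reflect (L : IsLongestCycle A C m x) (i : ℤ) :
    IsLongestCycle (flip A) C m fun k => x (i - k) where
  toIsCyclicWalk := L.toIsCyclicWalk.reflect i
  mem_iff v := (L.mem_iff v).trans
    ⟨fun ⟨k, hk⟩ => ⟨i - k, by simpa using hk⟩, fun ⟨k, hk⟩ => ⟨i - k, hk⟩⟩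
  le m' y hy := L.le m' _ (hy.reflect 0)

theorem card_filter (L : IsLongestCycle A C m x) (P : V → Prop) :
    #{v ∈ C | P v} = #{k ∈ Ico (0 : ℤ) m | P (x k)} := by
  have hC : C = (Ico (0 : ℤ) m).image x := by
    ext v
    simp only [L.mem_iff, mem_image, mem_Ico]
    refine ⟨?_, fun ⟨k, _, hk⟩ => ⟨k, hk⟩⟩
    rintro ⟨k, rfl⟩
    simpa using L.exists_mem_Ico 0 k
  rw [hC, filter_image, card_image_of_injOn]
  intro j hj k hk e
  simp only [coe_filter, mem_Ico, Set.mem_ofPred_eq] at hj hk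
  exact L.eq_of_lt_add (by lia) (by lia) e

theorem card_eq (L : IsLongestCycle A C m x) : #C = m := by
  simpa using L.card_filter fun _ => True

theorem not_bridge (L : IsLongestCycle A C m x) (hu : u ∉ C) (huv : ReachOff A C u v)
    (h₁ : A (x (-1)) u) : ¬A v (x 0) := by
  intro h₂
  obtain ⟨Z, hZ, hd, hC, hpos⟩ := huv.exists_isWalk hu
  obtain ⟨y, hy⟩ := L.insert hZ hd (fun k hk => hC _ hk (L.apply_mem k)) h₁ h₂
  have := L.le _ _ hy
  lia

theorem not_leaves_of_enters (L : IsLongestCycle A C m x) {k : ℤ} (h₁ : Enters A C z (x k)) :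
    ¬Leaves A C z (x (k + 1)) := by
  rintro ⟨v, -, h₂, hzv⟩
  obtain ⟨u, hu, h, huz⟩ := h₁
  exact (L.shift (k + 1)).not_bridge hu (huz.trans hzv) (by simpa using h) (by simpa using h₂)

theorem not_exchange (L : IsLongestCycle A C m x) {i l : ℤ} (hi : 0 ≤ i) (hil : i < l)
    (hl : l + 1 < m) (h₁ : Enters A C z (x (-1))) (h₂ : Leaves A C z (x (i + 1)))
    (h₃ : A (x l) (x 0)) : ¬A (x i) (x (l + 1)) := by
  intro h₄
  obtain ⟨u, hu, h, huz⟩ := h₁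
  obtain ⟨v, -, h', hzv⟩ := h₂
  obtain ⟨Z, hZ, hd, hC, hpos⟩ := ReachOff.exists_isWalk (huz.trans hzv) hu
  obtain ⟨y, hy, -⟩ := L.exchange hi hil (lt_add_one l) hl hZ hd
    (fun k hk => hC _ hk (L.apply_mem k)) h h' h₃ h₄
  have := L.le _ _ hy
  lia

theorem not_exchange_of_lt_add (L : IsLongestCycle A C m x) {i l k : ℤ} (hil : i < l) (hlk : l < k)
    (hki : k < i + m) (h₁ : Enters A C z (x k)) (h₂ : Leaves A C z (x (i + 1)))
    (h₃ : A (x l) (x (k + 1))) : ¬A (x i) (x (l + 1)) := by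
  have hx (j : ℤ) : x (j - (k + 1) + m + (k + 1)) = x j := by
    rw [← L.periodic j]
    congr 1
    ring
  have := (L.shift (k + 1)).not_exchange (i := i - (k + 1) + m) (l := l - (k + 1) + m) (z := z)
    (by lia) (by lia) (by lia)
  simp only [zero_add, hx, neg_add_cancel_comm_assoc,
    show ∀ j, j - (k + 1) + m + 1 = j + 1 - (k + 1) + m by lia] at this
  exact this (by simpa using h₁) h₂ h₃

variable [Fintype V] {π : Equiv.Perm V}

theorem card_into_add_card_leaves (L : IsLongestCycle A C m x) (H : IsOreOff A π) (hz : z ∉ C)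
    (h : Enters A C z (x (-1))) {k : V} (hzk : ReachOff A C z k) (hk : π k ≠ x 0) :
    m + 1 ≤ #{v ∈ C | A v (x 0)} + #{v ∈ C | Leaves A C z v} := by
  obtain ⟨u, hu, h, huz⟩ := h
  have hkC : k ∉ C := hzk.notMem hz
  have hnot {w : V} (hkw : ReachOff A C k w) : ¬A w (x 0) :=
    L.not_bridge hu ((huz.trans hzk).trans hkw) h
  have hore := H.ore (ne_of_mem_of_not_mem (L.apply_mem 0) hkC).symm (hnot .refl) hk
  rw [card_filter_eq_add_compl C, card_filter_eq_add_compl C] at hore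
  have hleaves : #{v ∈ C | A k v} ≤ #{v ∈ C | Leaves A C z v} :=
    card_le_card (monotone_filter_right _ fun v _ hv => ⟨k, hkC, hv, hzk⟩)
  have hdisj : Disjoint {v ∈ Cᶜ | A k v} {v ∈ Cᶜ | A v (x 0)} := by
    refine disjoint_left.2 fun w hw hw' => ?_
    simp only [mem_filter, mem_compl] at hw hw'
    exact hnot (.single ⟨hw.2, hkC, hw.1⟩) hw'.2
  have hoff : #({v ∈ Cᶜ | A k v} ∪ {v ∈ Cᶜ | A v (x 0)}) ≤ #(Cᶜ.erase k) := by
    refine card_le_card fun w hw => ?_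
    have := H.irrefl k
    have := hnot .refl
    grind
  rw [card_union_of_disjoint hdisj, card_erase_of_mem (mem_compl.2 hkC)] at hoff
  have := card_pos.2 ⟨k, mem_compl.2 hkC⟩
  have := card_add_card_compl C
  have := L.card_eq
  lia

theorem two_le_card_enters (L : IsLongestCycle A C m x) (H : IsOreOff A π)
    (hV : 4 ≤ Fintype.card V) (hz : z ∉ C) : 2 ≤ #{v ∈ C | Enters A C z v} := by
  set T : Finset V := {v | v ∉ C ∧ ReachOff A C v z} with hT
  have hm : 2 ≤ #C := by
    rw [L.card_eq]
    by_contra! hm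
    obtain rfl : m = 1 := by have := L.pos; lia
    exact H.irrefl (x 0) (by simpa [← L.periodic 0] using L.adj 0)
  have hCT : C ⊆ Tᶜ := fun v hv => by simp [hT, hv]
  refine (H.two_le_card_entering hV ⟨z, by simpa [hT, hz] using .refl⟩
    (hm.trans (card_le_card hCT))).trans (card_le_card fun a ha => ?_)
  simp only [hT, mem_filter, mem_compl, mem_univ, true_and, not_and] at ha ⊢
  obtain ⟨haT, t, ⟨ht, htz⟩, hat⟩ := ha
  exact ⟨by_contra fun haC => haT haC (.head ⟨hat, haC, ht⟩ htz), t, ht, hat, htz⟩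

theorem exists_enters (L : IsLongestCycle A C m x) (H : IsOreOff A π) (hV : 4 ≤ Fintype.card V)
    (hz : z ∉ C) (w : V) : ∃ k, Enters A C z (x k) ∧ x (k + 1) ≠ w := by
  obtain ⟨a, ha, b, hb, hab⟩ := one_lt_card.1 (L.two_le_card_enters H hV hz)
  simp only [mem_filter, L.mem_iff] at ha hb
  obtain ⟨⟨j, rfl⟩, hj⟩ := ha
  obtain ⟨⟨k, rfl⟩, hk⟩ := hb
  by_contra! h
  exact hab (L.eq_iff.2 (Int.ModEq.add_right_cancel' 1 (L.eq_iff.1 ((h j hj).trans (h k hk).symm))))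

theorem exists_leaves (L : IsLongestCycle A C m x) (H : IsOreOff A π) (hV : 4 ≤ Fintype.card V)
    (hz : z ∉ C) (w : V) : ∃ k, Leaves A C z (x (k + 1)) ∧ x k ≠ w := by
  obtain ⟨k, hk, hw⟩ := (L.reflect 0).exists_enters H.flip hV hz w
  exact ⟨0 - (k + 1), by simpa [enters_flip, sub_add_eq_sub_sub] using hk, hw⟩

end IsLongestCycle

end LongestCycles

section Counting

theorem image_add_one_union_subset {S T : Finset ℤ} {a b : ℤ} (hS : S ⊆ Ico a b)
    (hT : T ⊆ Ioc a b) : S.image (· + 1) ∪ T ⊆ Ioc a b :=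
  union_subset (image_subset_iff.2 fun l hl => by have := hS hl; grind) hT

theorem card_image_add_one_union {S T : Finset ℤ} (h : ∀ l ∈ S, l + 1 ∉ T) :
    #(S.image (· + 1) ∪ T) = #S + #T := by
  have hdisj : Disjoint (S.image (· + 1)) T := disjoint_left.2 (forall_mem_image.2 h)
  rw [card_union_of_disjoint hdisj, card_image_of_injective _ (add_left_injective 1)]

theorem card_add_card_le_of_succ_notMem {S T : Finset ℤ} {a b : ℤ} (hS : S ⊆ Ico a b)
    (hT : T ⊆ Ioc a b) (h : ∀ l ∈ S, l + 1 ∉ T) : #S + #T ≤ (b - a).toNat := by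
  rw [← card_image_add_one_union h, ← Int.card_Ioc]
  exact card_le_card (image_add_one_union_subset hS hT)

theorem mem_or_succ_mem_of_card_le {S T : Finset ℤ} {a b : ℤ} (hS : S ⊆ Ico a b)
    (hT : T ⊆ Ioc a b) (h : ∀ l ∈ S, l + 1 ∉ T) (hcard : (b - a).toNat ≤ #S + #T) {l : ℤ}
    (hl : l ∈ Ico a b) : l ∈ S ∨ l + 1 ∈ T := by
  have heq : S.image (· + 1) ∪ T = Ioc a b := eq_of_subset_of_card_le
    (image_add_one_union_subset hS hT) (by rwa [Int.card_Ioc, card_image_add_one_union h])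
  have hmem : l + 1 ∈ S.image (· + 1) ∪ T := heq ▸ by grind
  simpa using hmem

theorem card_filter_le_card_add_card {α : Type*} {P : α → Prop} {I J K : Finset α}
    (h : ∀ l ∈ I, P l → l ∈ J ∨ l ∈ K) : #{l ∈ I | P l} ≤ #{l ∈ J | P l} + #{l ∈ K | P l} := by
  refine (card_le_card ?_).trans (card_union_le _ _)
  intro l hl
  rw [mem_filter] at hl
  simpa [hl.2] using h l hl.1 hl.2

end Counting

section Detours

variable {V : Type*} {A : V → V → Prop} {π : Equiv.Perm V} {C : Finset V} {m : ℕ} {x : ℤ → V}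
  {z : V} {i : ℤ}

/-- From the cycle `x` one can step off at `x (-1)`, pass through the vertex `z` outside `C`, and
step back on at `x (i + 1)`, thus bypassing `x 0, …, x i`; moreover `π` does not exempt all pairs
that would witness Ore's condition at either end of the bypassed segment. -/
structure IsDetour (A : V → V → Prop) (π : Equiv.Perm V) (C : Finset V) (z : V) (x : ℤ → V)
    (i : ℤ) : Prop where
  nonneg : 0 ≤ i
  enters : Enters A C z (x (-1))
  leaves : Leaves A C z (x (i + 1))
  exists_start : ∃ k, ReachOff A C z k ∧ π k ≠ x 0
  exists_end : ∃ k, ReachOff A C k z ∧ π (x i) ≠ k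

theorem IsDetour.reflect (D : IsDetour A π C z x i) :
    IsDetour (flip A) π⁻¹ C z (fun k => x (i - k)) i where
  nonneg := D.nonneg
  enters := by simpa [enters_flip] using D.leaves
  leaves := by simpa [leaves_flip] using D.enters
  exists_start := by
    obtain ⟨k, hk, hπ⟩ := D.exists_end
    exact ⟨k, reachOff_flip.2 hk, fun e => hπ (by simpa using (Equiv.Perm.inv_eq_iff_eq.1 e).symm)⟩
  exists_end := by
    obtain ⟨k, hk, hπ⟩ := D.exists_start
    exact ⟨k, reachOff_flip.2 hk, fun e => hπ (by simp [← e])⟩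

/-- A detour bypassing the fewest vertices among all detours on longest cycles with vertex set
`C`. -/
structure IsMinDetour (A : V → V → Prop) (π : Equiv.Perm V) (C : Finset V) (m : ℕ) (z : V)
    (x : ℤ → V) (i : ℤ) : Prop extends IsLongestCycle A C m x, IsDetour A π C z x i where
  lt : i < m
  le_of_isDetour : ∀ {y j}, IsLongestCycle A C m y → IsDetour A π C z y j → i ≤ j

theorem IsLongestCycle.exists_isMinDetour [Fintype V] (L : IsLongestCycle A C m x)
    (H : IsOreOff A π) (hV : 4 ≤ Fintype.card V) (hz : z ∉ C) :
    ∃ y i, IsMinDetour A π C m z y i := by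
  have hex : ∃ i : ℤ, ∃ y, i < m ∧ IsLongestCycle A C m y ∧ IsDetour A π C z y i := by
    obtain ⟨k, hk, hkz⟩ := L.exists_enters H hV hz (π z)
    obtain ⟨j', hj', hjz⟩ := L.exists_leaves H hV hz (π⁻¹ z)
    obtain ⟨j, ⟨hkj, hjk⟩, hj⟩ := L.exists_mem_Ico (k + 1) j'
    have hj1 : x (j + 1) = x (j' + 1) := L.eq_iff.2 ((L.eq_iff.1 hj).add_right 1)
    refine ⟨j - (k + 1), fun t => x (t + (k + 1)), by lia, L.shift _, ⟨by lia, by simpa using hk,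
      ?_, ⟨z, .refl, by simpa using hkz.symm⟩, ⟨z, .refl, ?_⟩⟩⟩
    · rwa [show j - (k + 1) + 1 + (k + 1) = j + 1 by lia, hj1]
    · rw [sub_add_cancel, hj]
      exact fun e => hjz (by simp [← e])
  obtain ⟨i, ⟨y, hi, Ly, D⟩, hmin⟩ := Int.exists_least_of_bdd
    ⟨0, fun _ ⟨_, _, _, D⟩ => D.nonneg⟩ hex
  refine ⟨y, i, Ly, D, hi, fun {y' j} Ly' D' => ?_⟩
  by_contra! hji
  exact hji.not_ge (hmin j ⟨y', by lia, Ly', D'⟩)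

namespace IsMinDetour

theorem reflect (D : IsMinDetour A π C m z x i) :
    IsMinDetour (flip A) π⁻¹ C m z (fun k => x (i - k)) i where
  toIsLongestCycle := D.toIsLongestCycle.reflect i
  toIsDetour := D.toIsDetour.reflect
  lt := D.lt
  le_of_isDetour {_ j} L D' := D.le_of_isDetour (L.reflect j) D'.reflect

theorem eq_succ_of_enters (D : IsMinDetour A π C m z x i) {j : ℤ} (hj : j ∈ Ico 0 i)
    (h : Enters A C z (x j)) {k : V} (hk : ReachOff A C z k) : π k = x (j + 1) := by
  by_contra hπ
  rw [mem_Ico] at hj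
  have := D.le_of_isDetour (j := i - (j + 1)) (D.toIsLongestCycle.shift (j + 1))
    { nonneg := by lia
      enters := by simpa using h
      leaves := by simpa [show i - (j + 1) + 1 + (j + 1) = i + 1 by lia] using D.leaves
      exists_start := ⟨k, hk, by simpa using hπ⟩
      exists_end := by simpa using D.exists_end }
  lia

theorem eq_of_leaves (D : IsMinDetour A π C m z x i) {j : ℤ} (hj : j ∈ Ico 0 i)
    (h : Leaves A C z (x (j + 1))) {k : V} (hk : ReachOff A C k z) : π (x j) = k := by
  have := D.reflect.eq_succ_of_enters (j := i - (j + 1)) (by grind) (by simpa [enters_flip] using h)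
    (reachOff_flip.2 hk)
  rw [Equiv.Perm.inv_eq_iff_eq, show i - (i - (j + 1) + 1) = j by lia] at this
  exact this.symm

theorem card_enters_le (D : IsMinDetour A π C m z x i) :
    #{l ∈ Ico 0 i | Enters A C z (x l)} ≤ 1 := by
  refine card_le_one.2 fun j hj k hk => ?_
  rw [mem_filter] at hj hk
  have e := (D.eq_succ_of_enters hj.1 hj.2 .refl).symm.trans (D.eq_succ_of_enters hk.1 hk.2 .refl)
  have := D.lt
  have := D.eq_of_lt_add (by grind) (by grind) e
  lia

theorem card_leaves_le (D : IsMinDetour A π C m z x i) :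
    #{l ∈ Ioc 0 i | Leaves A C z (x l)} ≤ 1 := by
  refine (card_le_card_of_injOn (i - ·) (fun l hl => ?_) (sub_right_injective.injOn)).trans
    (D.reflect.card_enters_le)
  simp only [coe_filter, mem_Ioc, Set.mem_ofPred_eq, mem_Ico, enters_flip, sub_sub_cancel] at hl ⊢
  exact ⟨by lia, hl.2⟩

theorem succ_notMem_filter_from (D : IsMinDetour A π C m z x i) {l : ℤ}
    (hl : l ∈ {l ∈ Ioo i (m : ℤ) | A (x l) (x 0)}) :
    l + 1 ∉ {l ∈ Ioo i (m : ℤ) | A (x i) (x l)} := fun hl' => by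
  rw [mem_filter, mem_Ioo] at hl hl'
  exact D.not_exchange D.nonneg hl.1.1 hl'.1.2 D.enters D.leaves hl.2 hl'.2

theorem succ_notMem_filter_leaves (D : IsMinDetour A π C m z x i) {l : ℤ}
    (hl : l ∈ {l ∈ Ico i (m : ℤ) | Enters A C z (x l)}) :
    l + 1 ∉ {l ∈ Ioo i (m : ℤ) | Leaves A C z (x l)} := fun hl' =>
  D.not_leaves_of_enters (mem_filter.1 hl).2 (mem_filter.1 hl').2

variable [Fintype V]

theorem succ_le_card_into_add_card_leaves (D : IsMinDetour A π C m z x i) (H : IsOreOff A π)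
    (hz : z ∉ C) :
    m + 1 ≤ #{l ∈ Ioc 0 i | A (x l) (x 0)} + #{l ∈ Ioo i m | A (x l) (x 0)} +
      (#{l ∈ Ioc 0 i | Leaves A C z (x l)} + #{l ∈ Ioo i m | Leaves A C z (x l)}) := by
  obtain ⟨k, hk, hπ⟩ := D.exists_start
  refine (D.card_into_add_card_leaves H hz D.enters hk hπ).trans ?_
  rw [D.card_filter, D.card_filter]
  refine add_le_add (card_filter_le_card_add_card fun l hl h => ?_)
    (card_filter_le_card_add_card fun l hl h => ?_)
  · have := H.irrefl (x 0)
    grind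
  · have : ¬Leaves A C z (x 0) := D.not_leaves_of_enters D.enters
    grind

theorem succ_le_card_from_add_card_enters (D : IsMinDetour A π C m z x i) (H : IsOreOff A π)
    (hz : z ∉ C) :
    m + 1 ≤ #{l ∈ Ico 0 i | A (x i) (x l)} + #{l ∈ Ioo i m | A (x i) (x l)} +
      (#{l ∈ Ico 0 i | Enters A C z (x l)} + #{l ∈ Ico i m | Enters A C z (x l)}) := by
  obtain ⟨k, hk, hπ⟩ := D.reflect.exists_start
  have := D.reflect.card_into_add_card_leaves H.flip hz D.reflect.enters hk hπ
  simp only [leaves_flip, flip, sub_zero] at this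
  rw [D.card_filter, D.card_filter] at this
  refine this.trans (add_le_add (card_filter_le_card_add_card fun l hl h => ?_)
    (card_filter_le_card_add_card fun l hl _ => ?_))
  · have := H.irrefl (x i)
    grind
  · grind

/-- Adding up Ore's condition at both ends of the detour leaves no slack in the bounds that come
from the impossibility of longer cycles. -/
theorem tight_counts (D : IsMinDetour A π C m z x i) (H : IsOreOff A π) (hz : z ∉ C) :
    #{l ∈ Ico 0 i | Enters A C z (x l)} = 1 ∧ i.toNat ≤ #{l ∈ Ioc 0 i | A (x l) (x 0)} ∧
      (m - i).toNat ≤ #{l ∈ Ioo i m | A (x l) (x 0)} + #{l ∈ Ioo i m | A (x i) (x l)} ∧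
      (m - i).toNat ≤
        #{l ∈ Ico i m | Enters A C z (x l)} + #{l ∈ Ioo i m | Leaves A C z (x l)} := by
  have hstart := D.succ_le_card_into_add_card_leaves H hz
  have hend := D.succ_le_card_from_add_card_enters H hz
  have hinto : #{l ∈ Ioc 0 i | A (x l) (x 0)} ≤ i.toNat := by
    simpa using card_filter_le (Ioc 0 i) _
  have hfrom : #{l ∈ Ico 0 i | A (x i) (x l)} ≤ i.toNat := by
    simpa using card_filter_le (Ico 0 i) _
  have := card_add_card_le_of_succ_notMem (a := i) (b := m) (by grind) (by grind)
    fun _ => D.succ_notMem_filter_from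
  have := card_add_card_le_of_succ_notMem (a := i) (b := m) (by grind) (by grind)
    fun _ => D.succ_notMem_filter_leaves
  have := D.card_enters_le
  have := D.card_leaves_le
  have := D.lt
  have := D.nonneg
  lia

theorem exists_enters (D : IsMinDetour A π C m z x i) (H : IsOreOff A π) (hz : z ∉ C) :
    ∃ p ∈ Ico 0 i, Enters A C z (x p) := by
  have hcard : 0 < #{l ∈ Ico 0 i | Enters A C z (x l)} := by simp [(D.tight_counts H hz).1]
  simpa [Finset.Nonempty, and_assoc] using card_pos.1 hcard

theorem exists_leaves (D : IsMinDetour A π C m z x i) (H : IsOreOff A π) (hz : z ∉ C) :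
    ∃ q ∈ Ico 0 i, Leaves A C z (x (q + 1)) := by
  obtain ⟨p, hp, h⟩ := D.reflect.exists_enters H.flip hz
  refine ⟨i - (p + 1), by grind, ?_⟩
  rwa [enters_flip, show i - p = i - (p + 1) + 1 by lia] at h

theorem adj_into (D : IsMinDetour A π C m z x i) (H : IsOreOff A π) (hz : z ∉ C) {l : ℤ}
    (hl : l ∈ Ioc 0 i) : A (x l) (x 0) := by
  refine filter_card_eq (p := fun l => A (x l) (x 0)) (le_antisymm (card_filter_le _ _) ?_) l hl
  simpa using (D.tight_counts H hz).2.1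

theorem adj_from (D : IsMinDetour A π C m z x i) (H : IsOreOff A π) (hz : z ∉ C) {l : ℤ}
    (hl : l ∈ Ico 0 i) : A (x i) (x l) := by
  simpa [flip] using D.reflect.adj_into H.flip hz (l := i - l) (by grind)

theorem adj_into_or_adj_from (D : IsMinDetour A π C m z x i) (H : IsOreOff A π) (hz : z ∉ C)
    {l : ℤ} (hl : l ∈ Ico i m) : A (x l) (x 0) ∨ A (x i) (x (l + 1)) := by
  have := mem_or_succ_mem_of_card_le (by grind) (by grind)
    (fun _ => D.succ_notMem_filter_from) (D.tight_counts H hz).2.2.1 hl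
  grind

theorem enters_or_leaves (D : IsMinDetour A π C m z x i) (H : IsOreOff A π) (hz : z ∉ C) {l : ℤ}
    (hl : l ∈ Ico i m) : Enters A C z (x l) ∨ Leaves A C z (x (l + 1)) := by
  have := mem_or_succ_mem_of_card_le (by grind) (by grind)
    (fun _ => D.succ_notMem_filter_leaves) (D.tight_counts H hz).2.2.2 hl
  grind

end IsMinDetour

end Detours

section Collapse

variable {V : Type*} [Fintype V] {A : V → V → Prop} {π : Equiv.Perm V} {C : Finset V} {m : ℕ}
  {x : ℤ → V} {z : V}

namespace IsLongestCycle

theorem perm_apply_mem (L : IsLongestCycle A C m x) (H : IsOreOff A π) (hV : 4 ≤ Fintype.card V)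
    (hz : z ∉ C) : π z ∈ C := by
  obtain ⟨y, i, D⟩ := L.exists_isMinDetour H hV hz
  obtain ⟨p, hp, h⟩ := D.exists_enters H hz
  rw [D.eq_succ_of_enters hp h .refl]
  exact D.apply_mem _

/-- A minimal detour has an attachment which `π` blocks simultaneously for all vertices reachable
from `z`, and `π` is injective. -/
theorem eq_of_reachOff (L : IsLongestCycle A C m x) (H : IsOreOff A π) (hV : 4 ≤ Fintype.card V)
    (hz : z ∉ C) {v : V} (h : ReachOff A C z v) : v = z := by
  obtain ⟨y, i, D⟩ := L.exists_isMinDetour H hV hz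
  obtain ⟨p, hp, hpz⟩ := D.exists_enters H hz
  exact π.injective ((D.eq_succ_of_enters hp hpz h).trans (D.eq_succ_of_enters hp hpz .refl).symm)

theorem enters_iff (L : IsLongestCycle A C m x) (H : IsOreOff A π) (hV : 4 ≤ Fintype.card V)
    (hz : z ∉ C) {a : V} : Enters A C z a ↔ A a z := by
  constructor
  · rintro ⟨v, hv, h, hvz⟩
    rwa [L.eq_of_reachOff H hV hv hvz]
  · exact fun h => ⟨z, hz, h, .refl⟩

theorem leaves_iff (L : IsLongestCycle A C m x) (H : IsOreOff A π) (hV : 4 ≤ Fintype.card V)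
    (hz : z ∉ C) {b : V} : Leaves A C z b ↔ A z b := by
  rw [← enters_flip]
  exact (L.reflect 0).enters_iff H.flip hV hz

theorem not_adj_of_notMem (L : IsLongestCycle A C m x) (H : IsOreOff A π)
    (hV : 4 ≤ Fintype.card V) {u v : V} (hu : u ∉ C) (hv : v ∉ C) : ¬A u v := fun h =>
  H.irrefl u (L.eq_of_reachOff H hV hu (.single ⟨h, hu, hv⟩) ▸ h)

theorem card_out_add_card_in_le (L : IsLongestCycle A C m x) (H : IsOreOff A π)
    (hV : 4 ≤ Fintype.card V) (hz : z ∉ C) : #{w | A z w} + #{w | A w z} ≤ m := by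
  have hon (P : V → Prop) (hP : ∀ v ∉ C, ¬P v) : #{v | P v} = #{v ∈ C | P v} := by
    rw [card_filter_eq_add_compl C, filter_false_of_mem (s := Cᶜ) (by simpa using hP), card_empty,
      add_zero]
  rw [hon _ fun v hv => L.not_adj_of_notMem H hV hz hv,
    hon _ fun v hv => L.not_adj_of_notMem H hV hv hz, add_comm, (L.shift 1).card_filter (A z),
    L.card_filter (A · z), ← card_union_of_disjoint, ← filter_or]
  · simpa using card_filter_le (Ico (0 : ℤ) m) _
  · refine disjoint_filter.2 fun k _ h h' => L.not_leaves_of_enters ⟨z, hz, h, .refl⟩ ?_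
    exact ⟨z, hz, h', .refl⟩

theorem eq_compl_singleton (L : IsLongestCycle A C m x) (H : IsOreOff A π)
    (hV : 4 ≤ Fintype.card V) (hz : z ∉ C) : C = {z}ᶜ := by
  refine Subset.antisymm (fun v hv => by simpa using ne_of_mem_of_not_mem hv hz)
    fun v hv => by_contra fun hvC => ?_
  rw [mem_compl, mem_singleton] at hv
  have hvz := H.ore hv (L.not_adj_of_notMem H hV hvC hz)
    fun e => hz (e ▸ L.perm_apply_mem H hV hvC)
  have hzv := H.ore (Ne.symm hv) (L.not_adj_of_notMem H hV hz hvC)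
    fun e => hvC (e ▸ L.perm_apply_mem H hV hz)
  have := L.card_out_add_card_in_le H hV hz
  have := L.card_out_add_card_in_le H hV hvC
  have := L.card_eq
  have := card_lt_univ_of_notMem hz
  lia

end IsLongestCycle

end Collapse

section Tight

variable {V : Type*} [Fintype V] {A : V → V → Prop} {π : Equiv.Perm V} {m : ℕ} {x : ℤ → V}
  {z : V} {i s : ℤ}

theorem IsLongestCycle.card_out_add_le {C : Finset V} (L : IsLongestCycle A C m x)
    (H : IsOreOff A π) (hz : z ∉ C) {a b l : ℤ} (hbl : b < l + m) (hla : l ≤ a)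
    (hlz : ¬A (x l) z) (h : ∀ k ∈ Ioc a b, ¬A (x l) (x k)) :
    #{w | A (x l) w} + (b - a).toNat + 2 ≤ Fintype.card V := by
  have hzx (k : ℤ) : x k ≠ z := ne_of_mem_of_not_mem (L.apply_mem k) hz
  have hmiss : ∀ w ∈ insert (x l) (insert z ((Ioc a b).image x)), ¬A (x l) w := by
    simp only [forall_mem_insert, forall_mem_image]
    exact ⟨H.irrefl _, hlz, h⟩
  have hcard := card_filter_add_card_le hmiss
  rw [card_insert_of_notMem, card_insert_of_notMem, card_image_of_injOn, Int.card_Ioc] at hcard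
  · lia
  · intro j hj k hk e
    rw [coe_Ioc, Set.mem_Ioc] at hj hk
    exact L.eq_of_lt_add (by lia) (by lia) e
  · simp [hzx]
  · simp only [mem_insert, mem_image, mem_Ioc, not_or, not_exists, not_and]
    refine ⟨hzx l, fun k hk e => ?_⟩
    have := L.eq_of_lt_add (by lia) (by lia) e
    lia

theorem notMem_compl_singleton (z : V) : z ∉ ({z} : Finset V)ᶜ := by simp

/-- A minimal detour through `z`, where the longest cycle `x` avoids no vertex but `z`: on the part
of the cycle which the detour keeps, the vertices from `x s` on are joined to `z`, and the vertices
up to `x s` are joined from `z`. The standing hypotheses on `A` and `V` are bundled in. -/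
structure IsTight (A : V → V → Prop) (π : Equiv.Perm V) (m : ℕ) (z : V) (x : ℤ → V) (i s : ℤ) :
    Prop extends IsMinDetour A π {z}ᶜ m z x i where
  isOreOff : IsOreOff A π
  four_le : 4 ≤ Fintype.card V
  lt_s : i < s
  s_lt : s < m
  adj_iff : ∀ l ∈ Ico i m, A (x l) z ↔ s ≤ l
  adj_succ_iff : ∀ l ∈ Ico i m, A z (x (l + 1)) ↔ l < s

namespace IsMinDetour

variable {C : Finset V}

theorem perm_outside_ne (D : IsMinDetour A π C m z x i) (H : IsOreOff A π) (hz : z ∉ C) {l : ℤ}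
    (hl : l ∈ Ioc i m) : π z ≠ x l := by
  obtain ⟨p, hp, h⟩ := D.exists_enters H hz
  rw [D.eq_succ_of_enters hp h .refl]
  intro e
  have := D.eq_of_lt_add (by grind) (by grind) e
  grind

theorem perm_ne_outside (D : IsMinDetour A π C m z x i) (H : IsOreOff A π) (hz : z ∉ C) {l : ℤ}
    (hl : l ∈ Ico i m) : π (x l) ≠ z := by
  obtain ⟨q, hq, h⟩ := D.exists_leaves H hz
  rw [← D.eq_of_leaves hq h .refl]
  intro e
  have := D.eq_of_lt_add (by grind) (by grind) (π.injective e)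
  grind

/-- Otherwise bypassing `x (l + 1)` alone would be a shorter detour. -/
theorem enters_succ (D : IsMinDetour A π C m z x i) (H : IsOreOff A π) (hz : z ∉ C) {l : ℤ}
    (hl : l ∈ Ico i (m - 1)) (h : Enters A C z (x l)) : Enters A C z (x (l + 1)) := by
  refine (D.enters_or_leaves H hz (l := l + 1) (by grind)).resolve_right fun h' => ?_
  obtain ⟨p, hp, -⟩ := D.exists_enters H hz
  have := D.le_of_isDetour (j := 0) (D.toIsLongestCycle.shift (l + 1))
    { nonneg := le_rfl
      enters := by simpa using h
      leaves := by simpa [add_comm, add_left_comm] using h'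
      exists_start := ⟨z, .refl, D.perm_outside_ne H hz (by grind)⟩
      exists_end := ⟨z, .refl, D.perm_ne_outside H hz (by grind)⟩ }
  grind

end IsMinDetour

theorem IsLongestCycle.exists_isTight {C : Finset V} (L : IsLongestCycle A C m x)
    (H : IsOreOff A π) (hV : 4 ≤ Fintype.card V) (hz : z ∉ C) :
    ∃ y i s, IsTight A π m z y i s := by
  obtain rfl : C = {z}ᶜ := L.eq_compl_singleton H hV hz
  obtain ⟨y, i, D⟩ := L.exists_isMinDetour H hV hz
  have henters (a : V) : Enters A {z}ᶜ z a ↔ A a z := L.enters_iff H hV hz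
  have hleaves (b : V) : Leaves A {z}ᶜ z b ↔ A z b := L.leaves_iff H hV hz
  have hlast : A (y (m - 1)) z := by
    rw [← henters, show (m : ℤ) - 1 = -1 + m by lia, D.periodic]
    exact D.enters
  have hi := D.lt
  obtain ⟨s, ⟨⟨his, hsm⟩, hs⟩, hmin⟩ := Int.exists_least_of_bdd
    (P := fun l => (i ≤ l ∧ l < m) ∧ A (y l) z) ⟨i, fun _ h => h.1.1⟩
    ⟨m - 1, ⟨by lia, by lia⟩, hlast⟩
  have hadj : ∀ l ∈ Ico i m, A (y l) z ↔ s ≤ l := by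
    refine fun l hl => ⟨fun h => hmin l ⟨mem_Ico.1 hl, h⟩, fun hsl => ?_⟩
    induction l, hsl using Int.leInduction with
    | base => exact hs
    | succ l hsl ih =>
      rw [← henters]
      exact D.enters_succ H hz (by grind) ((henters _).2 (ih (by grind)))
  have hleaves_i : ¬A (y i) z := fun h =>
    D.not_leaves_of_enters ((henters _).2 h) D.leaves
  refine ⟨y, i, s, D, H, hV, his.lt_of_ne (by rintro rfl; exact hleaves_i hs), hsm, hadj,
    fun l hl => ?_⟩
  have := D.enters_or_leaves H hz hl
  have := D.not_leaves_of_enters (z := z) (k := l)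
  have := hadj l hl
  rw [henters, hleaves] at *
  grind

namespace IsTight

theorem enters_iff (T : IsTight A π m z x i s) {a : V} : Enters A {z}ᶜ z a ↔ A a z :=
  T.toIsLongestCycle.enters_iff T.isOreOff T.four_le (notMem_compl_singleton z)

theorem leaves_iff (T : IsTight A π m z x i s) {b : V} : Leaves A {z}ᶜ z b ↔ A z b :=
  T.toIsLongestCycle.leaves_iff T.isOreOff T.four_le (notMem_compl_singleton z)

theorem reflect (T : IsTight A π m z x i s) :
    IsTight (flip A) π⁻¹ m z (fun k => x (i - k)) i (i + m - s) where
  toIsMinDetour := T.toIsMinDetour.reflect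
  isOreOff := T.isOreOff.flip
  four_le := T.four_le
  lt_s := by have := T.s_lt; lia
  s_lt := by have := T.lt_s; lia
  adj_iff l hl := by
    have := T.adj_succ_iff (i + m - l - 1) (by grind)
    rw [show i + m - l - 1 + 1 = i - l + m by lia, T.periodic] at this
    exact this.trans (by lia)
  adj_succ_iff l hl := by
    have := T.adj_iff (i + m - l - 1) (by grind)
    rw [show i + m - l - 1 = i - (l + 1) + m by lia, T.periodic] at this
    exact this.trans (by lia)

theorem card_in_le (T : IsTight A π m z x i s) : #{w | A w z} ≤ (m - s).toNat + 1 := by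
  have hoff : {w ∈ ({z}ᶜᶜ : Finset V) | A w z} = ∅ := by simp [filter_singleton, T.isOreOff.irrefl]
  rw [card_filter_eq_add_compl {z}ᶜ, hoff, card_empty, add_zero, T.card_filter]
  have hsplit : #{l ∈ Ico 0 (m : ℤ) | A (x l) z} ≤
      #{l ∈ Ico 0 i | A (x l) z} + #{l ∈ Ico s m | A (x l) z} :=
    card_filter_le_card_add_card fun l hl h => by
      have := T.adj_iff l
      grind
  have hblocked := T.card_enters_le
  simp only [T.enters_iff] at hblocked
  have hkept : #{l ∈ Ico s m | A (x l) z} ≤ (m - s).toNat := by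
    simpa using card_filter_le (Ico s (m : ℤ)) _
  lia

theorem card_out_le (T : IsTight A π m z x i s) : #{w | A z w} ≤ (s - i).toNat + 1 := by
  have := T.reflect.card_in_le
  rwa [show (m : ℤ) - (i + m - s) = s - i by lia] at this

theorem adj_into_of_lt (T : IsTight A π m z x i s) {l : ℤ} (hl : l ∈ Ioo i s) :
    A (x l) (x 0) := by
  rw [mem_Ioo] at hl
  have := T.s_lt
  have := T.nonneg
  have hlm : l ∈ Ico i (m : ℤ) := by grind
  refine (T.adj_into_or_adj_from T.isOreOff (notMem_compl_singleton z) hlm).resolve_right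
    fun h => ?_
  have hmiss : ∀ k ∈ Ioc s (m : ℤ), ¬A (x l) (x k) := fun k hk h' => by
    rw [mem_Ioc] at hk
    have hk' : A (x (k - 1)) z := (T.adj_iff _ (by grind)).2 (by lia)
    exact T.not_exchange_of_lt_add hl.1 (by lia) (by lia) (T.enters_iff.2 hk') T.leaves
      (by rwa [sub_add_cancel]) h
  have hlz : ¬A (x l) z := by rw [T.adj_iff l hlm]; lia
  have hout := T.card_out_add_le T.isOreOff (notMem_compl_singleton z) (by lia) (by lia) hlz hmiss
  have hore := T.isOreOff.ore (ne_of_mem_of_not_mem (T.apply_mem l) (notMem_compl_singleton z)) hlz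
    (T.perm_ne_outside T.isOreOff (notMem_compl_singleton z) hlm)
  have := T.card_in_le
  lia

theorem adj_from_of_le (T : IsTight A π m z x i s) {l : ℤ} (hl : l ∈ Ioo s m) :
    A (x i) (x l) := by
  have := T.reflect.adj_into_of_lt (l := i + m - l) (by grind)
  rwa [flip, sub_zero, show i - (i + m - l) = l - m by lia, ← T.periodic (l - m),
    sub_add_cancel] at this

theorem add_two_le (T : IsTight A π m z x i s) : i + 2 ≤ s := by
  have hi : i ∈ Ico i (m : ℤ) := by have := T.lt; grind
  have hmem : π (x i) ∈ ({z} : Finset V)ᶜ := by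
    simpa using T.perm_ne_outside T.isOreOff (notMem_compl_singleton z) hi
  obtain ⟨k, hk⟩ := (T.mem_iff _).1 hmem
  obtain ⟨t, ht, htk⟩ := T.exists_mem_Ico i k
  rw [Set.mem_Ico] at ht
  have hit : ¬A (x i) (x t) := by
    rw [htk, hk]
    exact T.isOreOff.not_adj _
  have hti : t ≠ i := by
    rintro rfl
    exact T.isOreOff.ne _ (hk.symm.trans htk.symm)
  have hti1 : t ≠ i + 1 := by
    rintro rfl
    exact hit (T.adj i)
  by_contra! hs
  refine hit ?_
  rcases lt_or_ge t m with htm | htm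
  · exact T.adj_from_of_le (by grind)
  · rw [← sub_add_cancel t m, T.periodic]
    exact T.adj_from T.isOreOff (notMem_compl_singleton z) (by grind)

theorem add_two_le_m (T : IsTight A π m z x i s) : s + 2 ≤ m := by
  have := T.reflect.add_two_le
  lia

theorem card_out_lt (T : IsTight A π m z x i s) : #{w | A z w} < #{w | A w (x s)} := by
  obtain ⟨q, hq, hzq⟩ := T.exists_leaves T.isOreOff (notMem_compl_singleton z)
  rw [mem_Ico] at hq
  have hπ : π (x q) = z := T.eq_of_leaves (mem_Ico.2 hq) hzq .refl
  have hlt := T.lt_s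
  have hlt' := T.s_lt
  have hmiss : ∀ k ∈ Ioc i s, ¬A (x q) (x k) := fun k hk => by
    rw [mem_Ioc] at hk
    have hinto : A (x (k - 1)) (x 0) := by
      rcases (show i ≤ k - 1 by lia).eq_or_lt with h | h
      · exact h ▸ T.adj_into T.isOreOff (notMem_compl_singleton z) (by grind)
      · exact T.adj_into_of_lt (by grind)
    have := T.not_exchange hq.1 (by lia) (by lia) T.enters hzq hinto
    rwa [sub_add_cancel] at this
  have hqz : ¬A (x q) z := hπ ▸ T.isOreOff.not_adj (x q)
  have hout := T.card_out_add_le T.isOreOff (notMem_compl_singleton z) (by lia) (by lia) hqz hmiss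
  have hqs : x q ≠ x s := fun e => by
    have := T.eq_of_lt_add (by lia) (by lia) e
    lia
  have hore := T.isOreOff.ore hqs (hmiss s (by grind))
    (by rw [hπ]; exact (ne_of_mem_of_not_mem (T.apply_mem s) (notMem_compl_singleton z)).symm)
  have := T.card_out_le
  lia

theorem card_in_lt (T : IsTight A π m z x i s) : #{w | A w z} < #{w | A (x s) w} := by
  have := T.reflect.card_out_lt
  rwa [show i - (i + m - s) = s - m by lia, ← T.periodic (s - m), sub_add_cancel] at this

/-- Reinserting the bypassed segment `x 0, …, x i` between `x (s - 1)` and `x (s + 1)` makes the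
detour lose `x s` only. -/
theorem exists_isCyclicWalk_ne (T : IsTight A π m z x i s) :
    ∃ y, IsCyclicWalk A m y ∧ ∀ k, y k ≠ x s := by
  have := T.add_two_le
  have := T.add_two_le_m
  obtain ⟨y, hy, hne⟩ := T.exchange T.nonneg (show i < s - 1 by lia) (show s - 1 < s + 1 by lia)
    (by lia) (IsWalk.singleton z) (List.nodup_singleton z)
    (by simpa using fun k => ne_of_mem_of_not_mem (T.apply_mem k) (notMem_compl_singleton z))
    (T.enters_iff.1 T.enters) (T.leaves_iff.1 T.leaves) (T.adj_into_of_lt (by grind))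
    (T.adj_from_of_le (by grind))
  refine ⟨y, ?_, hne s (by lia) (by lia)⟩
  convert hy using 1
  rw [List.length_singleton]
  lia

end IsTight

end Tight

section Spanning

variable {V : Type*} [Fintype V] {A : V → V → Prop} {π : Equiv.Perm V} {m : ℕ} {x : ℤ → V}

theorem IsCyclicWalk.isLongestCycle (h : IsCyclicWalk A m x)
    (hm : ∀ m' y, IsCyclicWalk A m' y → m' ≤ m) : IsLongestCycle A {v | ∃ k, x k = v} m x where
  toIsCyclicWalk := h
  mem_iff := by simp
  le := hm

namespace IsOreOff

theorem exists_adj (H : IsOreOff A π) (hV : 4 ≤ Fintype.card V) (u : V) : ∃ v, A u v := by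
  have h := H.flip.two_le_card_entering hV (singleton_nonempty u)
    (by rw [card_compl, card_singleton]; lia)
  obtain ⟨v, hv⟩ := card_pos.1 (two_pos.trans_le h)
  exact ⟨v, by simpa [_root_.flip] using (mem_filter.1 hv).2⟩

theorem exists_isCyclicWalk_card (H : IsOreOff A π) (hV : 4 ≤ Fintype.card V) :
    ∃ x, IsCyclicWalk A (Fintype.card V) x := by
  have : Nonempty V := Fintype.card_pos_iff.1 (by lia)
  obtain ⟨m, x, hx, hm⟩ := exists_longest_isCyclicWalk (H.exists_adj hV)
  by_contra hspan
  have hlt : m < Fintype.card V :=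
    (Fintype.card_eq_nat_card ▸ hx.le_card).lt_of_ne fun e => hspan ⟨x, e ▸ hx⟩
  set missed : Finset V := {z | ∃ y, IsCyclicWalk A m y ∧ ∀ k, y k ≠ z} with hmissed
  have hne : missed.Nonempty := by
    obtain ⟨z, -, hz⟩ := exists_mem_notMem_of_card_lt_card
      (s := {v | ∃ k, x k = v}) (t := univ) (by rwa [(hx.isLongestCycle hm).card_eq, card_univ])
    exact ⟨z, by simpa [hmissed] using ⟨x, hx, by simpa using hz⟩⟩
  obtain ⟨z, hz, hmax⟩ := missed.exists_max_image (fun z => #{w | A z w} + #{w | A w z}) hne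
  obtain ⟨y, hy, hyz⟩ : ∃ y, IsCyclicWalk A m y ∧ ∀ k, y k ≠ z := by simpa [hmissed] using hz
  obtain ⟨y', i, s, T⟩ := (hy.isLongestCycle hm).exists_isTight H hV (z := z) (by simpa using hyz)
  have := hmax (y' s) (by simpa [hmissed] using T.exists_isCyclicWalk_ne)
  have := T.card_out_lt
  have := T.card_in_lt
  lia

theorem exists_equiv (H : IsOreOff A π) (hV : 4 ≤ Fintype.card V) :
    ∃ e : Fin (Fintype.card V) ≃ V, ∀ i, A (e i) (e (finRotate _ i)) := by
  obtain ⟨x, hx⟩ := H.exists_isCyclicWalk_card hV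
  have hrot (n : ℕ) (i : Fin n) : ((finRotate n i : ℕ) : ℤ) = (i + 1) % n := by
    cases n with
    | zero => exact i.elim0
    | succ n => simp [finRotate_apply, Fin.val_add]
  refine ⟨Equiv.ofBijective _
    ((Fintype.bijective_iff_injective_and_card _).2 ⟨hx.injective_fin, by simp⟩), fun i => ?_⟩
  simp only [Equiv.ofBijective_apply]
  rw [hrot, hx.apply_emod]
  exact hx.adj i

end IsOreOff

end Spanning

section Digraphs

variable {V : Type*}

/-- The permutation that maps each vertex to its successor along the cyclic enumeration `e`. -/
def cyclicSucc {n : ℕ} (e : Fin n ≃ V) : Equiv.Perm V := e.permCongr (finRotate n)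

theorem cyclicSucc_apply {n : ℕ} (e : Fin n ≃ V) (i : Fin n) :
    cyclicSucc e (e i) = e (finRotate n i) := by
  simp [cyclicSucc]

theorem cyclicSucc_ne {n : ℕ} (hn : 2 ≤ n) (e : Fin n ≃ V) (v : V) : cyclicSucc e v ≠ v := by
  obtain ⟨i, rfl⟩ := e.surjective v
  obtain ⟨k, rfl⟩ := Nat.exists_eq_add_of_le' hn
  rw [cyclicSucc_apply, e.injective.ne_iff, ← Equiv.Perm.mem_support, support_finRotate]
  exact mem_univ i

variable [Fintype V] {D : Digraph V} {π : Equiv.Perm V}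

theorem outDeg_eq_card (D : Digraph V) (v : V) : D.outDeg v = #{w | D.Adj v w} := by
  rw [Digraph.outDeg, ← Set.ncard_coe_finset, coe_filter_univ]

theorem inDeg_eq_card (D : Digraph V) (v : V) : D.inDeg v = #{u | D.Adj u v} := by
  rw [Digraph.inDeg, ← Set.ncard_coe_finset, coe_filter_univ]

theorem card_filter_le_card_filter_ne_add_one (P : V → Prop) (a : V) :
    #{w | P w} ≤ #{w | P w ∧ w ≠ a} + 1 := by
  refine (card_le_card fun w hw => ?_).trans (card_insert_le a _)
  by_cases h : w = a <;> simp_all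

theorem isOreOff_of_degrees (hD : D.IsSimple)
    (hdeg : ∀ u v : V, u ≠ v → ¬D.Adj u v → Fintype.card V + 2 ≤ D.outDeg u + D.inDeg v)
    (hπ : ∀ v, π v ≠ v) : IsOreOff (fun u v => D.Adj u v ∧ π u ≠ v) π where
  irrefl v h := hD v h.1
  ne := hπ
  not_adj v h := h.2 rfl
  ore {u v} huv h hp := by
    have hadd := hdeg u v huv fun h' => h ⟨h', hp⟩
    rw [outDeg_eq_card, inDeg_eq_card] at hadd
    have hout := card_filter_le_card_filter_ne_add_one (fun w => D.Adj u w) (π u)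
    have hin := card_filter_le_card_filter_ne_add_one (fun w => D.Adj w v) (π⁻¹ v)
    simp only [ne_comm (b := π u), Ne, Equiv.Perm.eq_inv_iff_eq] at hout hin ⊢
    lia

theorem adj_of_card_le_three (hD : D.IsSimple) (hn : Fintype.card V ≤ 3)
    (hdeg : ∀ u v : V, u ≠ v → ¬D.Adj u v → Fintype.card V + 2 ≤ D.outDeg u + D.inDeg v)
    {u v : V} (huv : u ≠ v) : D.Adj u v := by
  by_contra h
  have hadd := hdeg u v huv h
  rw [outDeg_eq_card, inDeg_eq_card] at hadd
  have hout : #{w | D.Adj u w} < Fintype.card V :=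
    card_lt_univ_of_notMem (x := u) (by simpa using hD u)
  have hin : #{w | D.Adj w v} < Fintype.card V :=
    card_lt_univ_of_notMem (x := v) (by simpa using hD v)
  lia

theorem exists_equiv_forall_perm_ne (hn : Fintype.card V = 3) (hπ : ∀ v, π v ≠ v) :
    ∃ e : Fin (Fintype.card V) ≃ V, ∀ i, π (e i) ≠ e (finRotate _ i) := by
  have hfin : ∀ σ : Equiv.Perm (Fin 3), (∀ i, σ i ≠ i) →
      ∃ e : Equiv.Perm (Fin 3), ∀ i, σ (e i) ≠ e (finRotate 3 i) := by decide
  rw [hn]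
  have f := (Fintype.equivFinOfCardEq hn).symm
  obtain ⟨e, he⟩ := hfin (f.symm.permCongr π) fun i h =>
    hπ (f i) (by simpa [Equiv.symm_apply_eq] using h)
  exact ⟨e.trans f, fun i h => he i (by simpa [Equiv.symm_apply_eq] using h)⟩

theorem exists_equiv_of_degrees (hD : D.IsSimple) (hn : 2 < Fintype.card V)
    (hdeg : ∀ u v : V, u ≠ v → ¬D.Adj u v → Fintype.card V + 2 ≤ D.outDeg u + D.inDeg v)
    (hπ : ∀ v, π v ≠ v) :
    ∃ e : Fin (Fintype.card V) ≃ V,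
      ∀ i, D.Adj (e i) (e (finRotate _ i)) ∧ π (e i) ≠ e (finRotate _ i) := by
  rcases Nat.lt_or_ge 3 (Fintype.card V) with h3 | h3
  · exact (isOreOff_of_degrees hD hdeg hπ).exists_equiv h3
  · obtain ⟨e, he⟩ := exists_equiv_forall_perm_ne (by lia) hπ
    refine ⟨e, fun i => ⟨adj_of_card_le_three hD h3 hdeg ?_, he i⟩⟩
    rw [← cyclicSucc_apply]
    exact (cyclicSucc_ne (by lia) e (e i)).symm

theorem isHamiltonianCycle_range (e : Fin (Fintype.card V) ≃ V)
    (h : ∀ i, D.Adj (e i) (e (finRotate _ i))) :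
    D.IsHamiltonianCycle (Set.range fun i => (e i, e (finRotate _ i))) :=
  ⟨Set.forall_mem_range.2 h, e, rfl⟩

end Digraphs

theorem mainTheorem5 {V : Type*} [Fintype V] (D : Digraph V) (hD : D.IsSimple)
    (hn : 2 < Fintype.card V)
    (hdeg : ∀ u v : V, u ≠ v → ¬ D.Adj u v → Fintype.card V + 2 ≤ D.outDeg u + D.inDeg v) :
    ∃ C₁ C₂ : Set (V × V),
      D.IsHamiltonianCycle C₁ ∧ D.IsHamiltonianCycle C₂ ∧ Disjoint C₁ C₂ := by
  have hsucc (e : Fin (Fintype.card V) ≃ V) : ∀ v, cyclicSucc e v ≠ v := cyclicSucc_ne hn.le e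
  obtain ⟨e₁, h₁⟩ := exists_equiv_of_degrees hD hn hdeg (hsucc (Fintype.equivFin V).symm)
  obtain ⟨e₂, h₂⟩ := exists_equiv_of_degrees hD hn hdeg (hsucc e₁)
  refine ⟨_, _, isHamiltonianCycle_range e₁ fun i => (h₁ i).1,
    isHamiltonianCycle_range e₂ fun i => (h₂ i).1, Set.disjoint_left.2 ?_⟩
  rintro _ ⟨i, rfl⟩ ⟨j, hj⟩
  obtain ⟨hij, hij'⟩ := Prod.mk.inj hj
  exact (h₂ j).2 (by rw [hij, hij', cyclicSucc_apply])
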